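/- For a prime $p$ and a finite field $k$ of characteristic $p$, let $W_2(k)$ denote the ring of $p$-typical Witt vectors of length $2$ over $k$, with its reduction homomorphism $W_2(k)\to k$. A finite group $G$ has property $L_p$ if for every integer $n\ge 1$ and every finite field $k$ of characteristic $p$, each homomorphism $G\to \mathrm{GL}_n(k)$ lifts, along the reduction map $\mathrm{GL}_n(W_2(k))\to\mathrm{GL}_n(k)$, to a homomorphism $G\to \mathrm{GL}_n(W_2(k))$. (1) Let $p>3$ be a prime. A finite $p$-group has property $L_p$ if and only if it is trivial. (2) A finite $3$-group has property $L_3$ if and only if it is trivial or isomorphic to $\mathbb{Z}/3\mathbb{Z}$. (3) For every integer $n\ge 0$, the group $\mathbb{Z}/2^n\mathbb{Z}$ has property $L_2$. (4) If a finite $2$-group $G$ has property $L_2$, then $G$ is either cyclic or a generalized quaternion group, i.e. isomorphic, for some $m\ge 1$, to the group $\langle a,x \mid a^{2^{m+1}}=1,\ x^2=a^{2^m},\ x^{-1}ax=a^{-1}\rangle$ of order $2^{m+2}$. -/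

import Mathlib

universe u

namespace LiftableGroups

/-- `W₂(k)`, the ring of `p`-typical Witt vectors of length two over `k`. -/
abbrev W2 (p : ℕ) (k : Type*) : Type _ := TruncatedWittVector p 2 k

/-- The reduction homomorphism `W₂(k) → k`, sending `(x₀, x₁)` to `x₀`. -/
noncomputable def reduction (p : ℕ) [Fact p.Prime] (k : Type*) [CommRing k] : W2 p k →+* k where
  toFun x := x.coeff 0
  map_one' := by
    have h := WittVector.coeff_truncate (p := p) (n := 2) (1 : WittVector p k) 0
    rw [map_one] at h
    rw [h]
    exact map_one (WittVector.constantCoeff (p := p) (R := k))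
  map_zero' := TruncatedWittVector.coeff_zero p 2 k 0
  map_mul' x y := by
    obtain ⟨x, rfl⟩ := WittVector.truncate_surjective p 2 k x
    obtain ⟨y, rfl⟩ := WittVector.truncate_surjective p 2 k y
    rw [← map_mul]
    simp only [WittVector.coeff_truncate]
    exact map_mul (WittVector.constantCoeff (p := p) (R := k)) x y
  map_add' x y := by
    obtain ⟨x, rfl⟩ := WittVector.truncate_surjective p 2 k x
    obtain ⟨y, rfl⟩ := WittVector.truncate_surjective p 2 k y
    rw [← map_add]
    simp only [WittVector.coeff_truncate]
    exact map_add (WittVector.constantCoeff (p := p) (R := k)) x y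

/-- The homomorphism `g : G → GLₙ(W₂(k))` lifts `f : G → GLₙ(k)`. -/
def IsLiftOf {p : ℕ} [Fact p.Prime] {G : Type*} [Group G] {k : Type*} [Field k] {n : ℕ}
    (g : G →* Matrix.GeneralLinearGroup (Fin n) (W2 p k))
    (f : G →* Matrix.GeneralLinearGroup (Fin n) k) : Prop :=
  (Matrix.GeneralLinearGroup.map (reduction p k)).comp g = f

/-- Property `L_p` of a (discrete) group `G`: every homomorphism `G → GLₙ(k)`, with `n ≥ 1` and
`k` a finite field of characteristic `p`, lifts to a homomorphism `G → GLₙ(W₂(k))`.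
(Every finite field is isomorphic to one in `Type`, so letting `k` range over `Type` is no
restriction.) -/
def HasPropertyL (p : ℕ) [Fact p.Prime] (G : Type*) [Group G] : Prop :=
  ∀ (k : Type) [Field k] [Finite k] [CharP k p] (n : ℕ), 0 < n →
    ∀ f : G →* Matrix.GeneralLinearGroup (Fin n) k,
      ∃ g : G →* Matrix.GeneralLinearGroup (Fin n) (W2 p k), IsLiftOf g f

/-- `G` is a generalized quaternion 2-group: it is isomorphic to the group of order `2 ^ (m + 2)`,
`m ≥ 1`, with presentation `⟨a, x | a ^ (2 ^ (m + 1)) = 1, x² = a ^ (2 ^ m), x⁻¹ a x = a⁻¹⟩`. -/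
def IsGeneralizedQuaternion (G : Type*) [Group G] : Prop :=
  ∃ m : ℕ, 1 ≤ m ∧ Nonempty (G ≃* QuaternionGroup (2 ^ m))

end LiftableGroups

/-! The obstructions rest on two facts about `W2 p k`: the kernel of reduction has square zero, and
it is exactly the annihilator of `p`. A lifted relation such as `(1 + M) ^ p = 1` therefore expands
to `p * M = 0`, which is absurd when `M` has nonzero reduction.

By `HasPropertyL.subgroup`, property `L_p` passes to subgroups, so it suffices to obstruct small
groups: ℤ/p for `p > 3`, ℤ/9, and (ℤ/p)² for `p = 2, 3`, the last realised as the additive group of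
the field with `p ^ 2` elements acting by unipotent `2 × 2` matrices. A 3-group of order at least 9
has a subgroup of order 9, which settles `p = 3`. A nontrivial 2-group has a central involution, so
excluding (ℤ/2)² leaves at most one involution, and the classical classification
`isCyclic_or_isGeneralizedQuaternion` applies.

For the positive results, a matrix over `k` of order dividing `p ^ r` is conjugate to a sum of
companion matrices of `(X - 1) ^ d` with `d ≤ p ^ r`. It is enough to lift each `(X - 1) ^ d` to a
monic divisor of `X ^ p ^ r - 1`, and products of cyclotomic polynomials do this for `p = 2`, and
for `p ^ r = 3`. -/

namespace LiftableGroups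

/-! ### Arithmetic of Witt vectors of length two -/

section Witt

variable {p : ℕ} [Fact p.Prime] {k : Type*} [Field k]

lemma reduction_truncate (x : WittVector p k) :
    reduction p k (WittVector.truncate 2 x) = x.coeff 0 :=
  WittVector.coeff_truncate (p := p) (n := 2) x 0

lemma reduction_surjective : Function.Surjective (reduction p k) := fun a =>
  ⟨WittVector.truncate 2 (WittVector.teichmuller p a), by
    rw [reduction_truncate, WittVector.teichmuller_coeff_zero]⟩

lemma truncate_eq_zero_iff (x : WittVector p k) :
    WittVector.truncate 2 x = (0 : W2 p k) ↔ x.coeff 0 = 0 ∧ x.coeff 1 = 0 := by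
  constructor
  · intro h
    constructor
    · have := WittVector.coeff_truncate (p := p) (n := 2) x 0
      rw [h, TruncatedWittVector.coeff_zero] at this
      exact this.symm
    · have := WittVector.coeff_truncate (p := p) (n := 2) x 1
      rw [h, TruncatedWittVector.coeff_zero] at this
      exact this.symm
  · rintro ⟨h0, h1⟩
    ext i
    rw [WittVector.coeff_truncate, TruncatedWittVector.coeff_zero]
    fin_cases i
    · exact h0
    · exact h1

variable [CharP k p]

lemma natCast_mul_eq_zero_iff (x : W2 p k) : (p : W2 p k) * x = 0 ↔ reduction p k x = 0 := by
  obtain ⟨x, rfl⟩ := WittVector.truncate_surjective p 2 k x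
  rw [reduction_truncate, ← map_natCast (WittVector.truncate (p := p) (R := k) 2) p, ← map_mul,
    truncate_eq_zero_iff, mul_comm, WittVector.mul_charP_coeff_zero,
    WittVector.mul_charP_coeff_succ]
  simp [(Fact.out : p.Prime).ne_zero]

/-- Both factors lift to images of the Verschiebung `V`, and a product of two such images lies in
the image of `V²`, which truncation at length two kills. -/
lemma mul_eq_zero_of_reduction_eq_zero {x y : W2 p k} (hx : reduction p k x = 0)
    (hy : reduction p k y = 0) : x * y = 0 := by
  obtain ⟨x, rfl⟩ := WittVector.truncate_surjective p 2 k x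
  obtain ⟨y, rfl⟩ := WittVector.truncate_surjective p 2 k y
  rw [reduction_truncate] at hx hy
  have hx' := WittVector.eq_iterate_verschiebung (x := x) (n := 1) (by simpa using hx)
  have hy' := WittVector.eq_iterate_verschiebung (x := y) (n := 1) (by simpa using hy)
  rw [← map_mul, truncate_eq_zero_iff, hx', hy', WittVector.iterate_verschiebung_mul]
  have key : ∀ z : WittVector p k, (WittVector.verschiebung^[1 + 1] z).coeff 0 = 0 ∧
      (WittVector.verschiebung^[1 + 1] z).coeff 1 = 0 := by
    intro z
    refine ⟨WittVector.verschiebung_coeff_zero _, ?_⟩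
    exact (WittVector.verschiebung_coeff_succ _ 0).trans (WittVector.verschiebung_coeff_zero _)
  exact key _

lemma isUnit_of_reduction_ne_zero {x : W2 p k} (hx : reduction p k x ≠ 0) : IsUnit x := by
  obtain ⟨y, hy⟩ := reduction_surjective (p := p) (reduction p k x)⁻¹
  have h : reduction p k (1 - x * y) = 0 := by simp [hy, hx]
  have h2 := mul_eq_zero_of_reduction_eq_zero h h
  refine IsUnit.of_mul_eq_one (y * (2 - x * y)) ?_
  linear_combination -h2

instance : Nontrivial (W2 p k) := (reduction p k).domain_nontrivial

end Witt

/-! ### Matrices over Witt vectors of length two -/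

section Lift

variable {p : ℕ} [Fact p.Prime] {k : Type*} [Field k]

/-- Entrywise reduction of square matrices over `W₂(k)`. -/
noncomputable abbrev reductionMatrix (p : ℕ) [Fact p.Prime] (k ι : Type*) [Field k] [Fintype ι]
    [DecidableEq ι] : Matrix ι ι (W2 p k) →+* Matrix ι ι k := (reduction p k).mapMatrix

variable {ι : Type*} [Fintype ι] [DecidableEq ι]

lemma reductionMatrix_surjective : Function.Surjective (reductionMatrix p k ι) := fun A =>
  ⟨A.map (Function.surjInv reduction_surjective), by
    ext i j; simp [Function.surjInv_eq reduction_surjective]⟩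

lemma reductionMatrix_eq_zero_iff {X : Matrix ι ι (W2 p k)} :
    reductionMatrix p k ι X = 0 ↔ ∀ i j, reduction p k (X i j) = 0 := by
  rw [← Matrix.ext_iff]; rfl

variable [CharP k p]

lemma matrix_mul_eq_zero_of_reduction_eq_zero {X Y : Matrix ι ι (W2 p k)}
    (hX : reductionMatrix p k ι X = 0) (hY : reductionMatrix p k ι Y = 0) : X * Y = 0 := by
  rw [reductionMatrix_eq_zero_iff] at hX hY
  ext i j : 1
  rw [Matrix.mul_apply]
  exact Finset.sum_eq_zero fun l _ => mul_eq_zero_of_reduction_eq_zero (hX i l) (hY l j)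

lemma natCast_mul_matrix_eq_zero_iff (X : Matrix ι ι (W2 p k)) :
    (p : Matrix ι ι (W2 p k)) * X = 0 ↔ reductionMatrix p k ι X = 0 := by
  rw [reductionMatrix_eq_zero_iff, ← nsmul_eq_mul, ← Matrix.ext_iff]
  simp only [Matrix.smul_apply, nsmul_eq_mul, Matrix.zero_apply, natCast_mul_eq_zero_iff]

end Lift

/-! ### Property `L_p` in matrix form, and its inheritance by subgroups -/

section PropertyL

variable {p : ℕ} [Fact p.Prime] {G : Type*} [Group G]

lemma HasPropertyL.exists_matrix_lift (h : HasPropertyL p G) {k : Type} [Field k] [Finite k]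
    [CharP k p] {ι : Type*} [Fintype ι] [DecidableEq ι] (f : G →* Matrix ι ι k) :
    ∃ g : G →* Matrix ι ι (W2 p k), ∀ x, reductionMatrix p k ι (g x) = f x := by
  rcases isEmpty_or_nonempty ι with hι | hι
  · exact ⟨1, fun x => Subsingleton.elim _ _⟩
  let e := Fintype.equivFin ι
  obtain ⟨g, hg⟩ := h k (Fintype.card ι) Fintype.card_pos
    (((Matrix.reindexAlgEquiv k k e : _ →* _).comp f).toHomUnits)
  refine ⟨((Matrix.reindexAlgEquiv (W2 p k) (W2 p k) e.symm : _ →* _).comp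
    ((Units.coeHom _).comp g)), fun x => ?_⟩
  have hx := congr_arg Units.val (DFunLike.congr_fun hg x)
  ext i j
  have := congr_fun (congr_fun hx (e i)) (e j)
  simpa [Matrix.coe_reindexAlgEquiv] using this

lemma hasPropertyL_of_matrix_lift (h : ∀ (k : Type) [Field k] [Finite k] [CharP k p] (n : ℕ)
      (f : G →* Matrix (Fin n) (Fin n) k), ∃ g : G →* Matrix (Fin n) (Fin n) (W2 p k),
        ∀ x, reductionMatrix p k (Fin n) (g x) = f x) : HasPropertyL p G := by
  intro k _ _ _ n _ f
  obtain ⟨g, hg⟩ := h k n ((Units.coeHom _).comp f)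
  refine ⟨g.toHomUnits, ?_⟩
  ext x : 2
  exact hg x

lemma HasPropertyL.of_mulEquiv {H : Type*} [Group H] (e : G ≃* H) (h : HasPropertyL p G) :
    HasPropertyL p H := by
  refine hasPropertyL_of_matrix_lift fun k _ _ _ n f => ?_
  obtain ⟨g, hg⟩ := h.exists_matrix_lift (f.comp e.toMonoidHom)
  exact ⟨g.comp e.symm.toMonoidHom, fun x => by simpa using hg (e.symm x)⟩

section Induction

open Classical in
/-- The extension by zero of a map defined on a subgroup. -/
noncomputable def extendZero (K : Subgroup G) {R : Type*} [Zero R] (f : K → R) (x : G) : R :=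
  if hx : x ∈ K then f ⟨x, hx⟩ else 0

lemma extendZero_of_mem {K : Subgroup G} {R : Type*} [Zero R] (f : K → R) {x : G} (hx : x ∈ K) :
    extendZero K f x = f ⟨x, hx⟩ := dif_pos hx

lemma extendZero_of_notMem {K : Subgroup G} {R : Type*} [Zero R] (f : K → R) {x : G}
    (hx : x ∉ K) : extendZero K f x = 0 := dif_neg hx

lemma extendZero_mul {K : Subgroup G} {R : Type*} [Semiring R] (f : K →* R) (x : G) {y : G}
    (hy : y ∈ K) : extendZero K f x * extendZero K f y = extendZero K f (x * y) := by
  by_cases hx : x ∈ K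
  · rw [extendZero_of_mem _ hx, extendZero_of_mem _ hy, extendZero_of_mem _ (K.mul_mem hx hy),
      ← map_mul]
    rfl
  · rw [extendZero_of_notMem _ hx,
      extendZero_of_notMem _ fun h => hx ((K.mul_mem_cancel_right hy).1 h),
      zero_mul]

/-- The representation induced from a subgroup `K`, as a homomorphism to block matrices indexed by
the cosets of `K`, with respect to a section `s` of the projection `G → G ⧸ K`. -/
noncomputable def inducedHom (K : Subgroup G) [Fintype (G ⧸ K)] [DecidableEq (G ⧸ K)]
    (s : G ⧸ K → G) (hs : ∀ c, (s c : G ⧸ K) = c) {R : Type*} [Semiring R] (f : K →* R) :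
    G →* Matrix (G ⧸ K) (G ⧸ K) R where
  toFun x := Matrix.of fun c d => extendZero K f ((s c)⁻¹ * x * s d)
  map_one' := by
    ext c d
    rw [Matrix.of_apply, mul_one]
    by_cases hcd : c = d
    · subst hcd
      rw [inv_mul_cancel, extendZero_of_mem _ K.one_mem, Matrix.one_apply_eq]
      exact map_one f
    · rw [Matrix.one_apply_ne hcd, extendZero_of_notMem]
      rw [← QuotientGroup.eq, hs, hs]
      exact hcd
  map_mul' x y := by
    ext c e
    rw [Matrix.mul_apply, Finset.sum_eq_single ((y * s e : G) : G ⧸ K)]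
    · simp only [Matrix.of_apply]
      rw [extendZero_mul]
      · congr 1; group
      · rw [mul_assoc, ← QuotientGroup.eq, hs]
    · intro d _ hd
      simp only [Matrix.of_apply]
      rw [extendZero_of_notMem f (x := (s d)⁻¹ * y * s e), mul_zero]
      rw [mul_assoc, ← QuotientGroup.eq, hs]
      exact hd
    · simp

/-- Lift the induced representation and keep the block at the trivial coset. On `K` the other blocks
in its row and column reduce to zero, so they contribute products of two kernel elements, which
vanish; the block is thus multiplicative. -/
lemma HasPropertyL.subgroup [Finite G] (h : HasPropertyL p G) (K : Subgroup G) :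
    HasPropertyL p K := by
  classical
  have := Fintype.ofFinite (G ⧸ K)
  refine hasPropertyL_of_matrix_lift fun k _ _ _ n f => ?_
  let c₀ : G ⧸ K := ((1 : G) : G ⧸ K)
  -- Representing the trivial coset by `1` makes its block restrict on `K` to `f` itself rather than
  -- to a conjugate.
  let s : G ⧸ K → G := Function.update Quotient.out c₀ 1
  have hs₀ : s c₀ = 1 := Function.update_self ..
  have hs : ∀ c, (s c : G ⧸ K) = c := fun c => by
    by_cases hc : c = c₀
    · rw [hc, hs₀]
    · simp only [s, Function.update_of_ne hc]
      exact QuotientGroup.out_eq' c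
  obtain ⟨g, hg⟩ := h.exists_matrix_lift
    ((Matrix.compRingEquiv (G ⧸ K) (Fin n) k).toMulEquiv.toMonoidHom.comp
      (inducedHom K s hs f))
  have hblock : ∀ (x : K) (c d : G ⧸ K) (i j : Fin n), reduction p k (g x (c, i) (d, j)) =
      extendZero K f ((s c)⁻¹ * x * s d) i j := fun x c d i j =>
    congr_fun (congr_fun (hg x) (c, i)) (d, j)
  have hrow : ∀ (x : K) (d : G ⧸ K) (i j : Fin n), d ≠ c₀ →
      reduction p k (g x (c₀, i) (d, j)) = 0 := fun x d i j hd => by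
    rw [hblock, extendZero_of_notMem, Matrix.zero_apply]
    rw [hs₀, inv_one, one_mul, K.mul_mem_cancel_left x.2]
    intro hd'
    exact hd ((hs d).symm.trans (QuotientGroup.eq.2 (by simpa using hd')))
  have hcol : ∀ (x : K) (d : G ⧸ K) (i j : Fin n), d ≠ c₀ →
      reduction p k (g x (d, i) (c₀, j)) = 0 := fun x d i j hd => by
    rw [hblock, extendZero_of_notMem, Matrix.zero_apply]
    rw [hs₀, mul_one, K.mul_mem_cancel_right x.2, inv_mem_iff]
    intro hd'
    exact hd ((hs d).symm.trans (QuotientGroup.eq.2 (by simpa using hd')))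
  refine ⟨⟨⟨fun x => Matrix.of fun i j => g x (c₀, i) (c₀, j), ?_⟩, fun x y => ?_⟩, fun x => ?_⟩
  · ext i j
    simp [Matrix.one_apply]
  · ext i j
    simp only [Matrix.of_apply, Subgroup.coe_mul, map_mul, Matrix.mul_apply]
    rw [Fintype.sum_prod_type, Finset.sum_eq_single c₀]
    · intro d _ hd
      exact Finset.sum_eq_zero fun l _ =>
        mul_eq_zero_of_reduction_eq_zero (hrow x d i l hd) (hcol y d l j hd)
    · simp
  · ext i j
    refine (hblock x c₀ c₀ i j).trans ?_
    simp only [hs₀, inv_one, one_mul, mul_one]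
    rw [extendZero_of_mem _ x.2]

lemma HasPropertyL.of_injective [Finite G] (h : HasPropertyL p G) {H : Type*} [Group H]
    (φ : H →* G) (hφ : Function.Injective φ) : HasPropertyL p H :=
  (h.subgroup φ.range).of_mulEquiv (MonoidHom.ofInjective hφ).symm

end Induction

end PropertyL

/-! ### Small groups without property `L_p` -/

section Obstructions

/-- In the binomial expansion, the terms of degree `2` to `p - 1` are multiples of `p * M ^ 2`, and
`M ^ p` vanishes because `p ≥ 4`. -/
lemma natCast_mul_eq_zero_of_one_add_pow_eq_one {R : Type*} [Ring R] {p : ℕ} (hp : p.Prime)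
    (hp3 : 3 < p) {M : R} (h2 : (p : R) * M ^ 2 = 0) (h4 : M ^ 4 = 0) (h : (1 + M) ^ p = 1) :
    (p : R) * M = 0 := by
  rw [add_comm, (Commute.one_right M).add_pow, ← Finset.sum_subset
    (Finset.range_subset_range.2 (by lia : 2 ≤ p + 1))] at h
  · simpa [Finset.sum_range_succ, Nat.cast_comm] using h
  · intro m hm hm2
    rw [Finset.mem_range] at hm hm2
    rw [one_pow, mul_one]
    rcases Nat.lt_or_ge m p with hmp | hmp
    · obtain ⟨c, hc⟩ := hp.dvd_choose_self (by lia) hmp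
      obtain ⟨l, rfl⟩ : ∃ l, m = 2 + l := ⟨m - 2, by lia⟩
      rw [hc, Nat.cast_mul, ← mul_assoc, ← Nat.cast_comm p, pow_add, ← mul_assoc, h2, zero_mul,
        zero_mul]
    · rw [pow_eq_zero_of_le (by lia) h4, zero_mul]

/-- Modulo 9 the only surviving interior binomial coefficients are those of degrees 3 and 6, both
`84 = 3 + 9 * 9`. The hypotheses fit a lift of a nilpotent Jordan block of size four, whose cube is
nonzero. -/
lemma three_mul_pow_three_eq_zero_of_one_add_pow_eq_one {R : Type*} [Ring R] {M : R}
    (h9 : (9 : R) = 0) (h4 : 3 * M ^ 4 = 0) (h8 : M ^ 8 = 0) (h : (1 + M) ^ 9 = 1) :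
    3 * M ^ 3 = 0 := by
  have key : (1 + M) ^ 9 = 1 + 3 * M ^ 3 + 9 * (M + 4 * M ^ 2 + 9 * M ^ 3 + 14 * M ^ 4 +
      14 * M ^ 5 + 9 * M ^ 6 + 4 * M ^ 7 + M ^ 8) + 3 * M ^ 4 * M ^ 2 + M ^ 8 * M := by
    noncomm_ring
  rw [h, h9, h4, h8] at key
  simpa using key

/-- The representation of the additive group of a field by upper unipotent matrices. -/
def unipotentHom (k : Type*) [Field k] : Multiplicative k →* Matrix (Fin 2) (Fin 2) k where
  toFun x := !![1, x.toAdd; 0, 1]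
  map_one' := by simp [Matrix.one_fin_two]
  map_mul' x y := by simp [add_comm]

lemma not_hasPropertyL_multiplicative_zmod {p : ℕ} [Fact p.Prime] (hp : 3 < p) :
    ¬ HasPropertyL p (Multiplicative (ZMod p)) := by
  intro h
  obtain ⟨g, hg⟩ := h.exists_matrix_lift (unipotentHom (ZMod p))
  set M := g (Multiplicative.ofAdd 1) - 1 with hM
  have hred : reductionMatrix p (ZMod p) (Fin 2) M = !![0, 1; 0, 0] := by
    rw [hM, map_sub, hg, RingHom.map_one, Matrix.one_fin_two]
    ext i j
    fin_cases i <;> fin_cases j <;> simp [unipotentHom]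
  have hred2 : reductionMatrix p (ZMod p) (Fin 2) (M ^ 2) = 0 := by
    rw [map_pow, hred, sq]
    ext i j
    fin_cases i <;> fin_cases j <;> simp
  have h4 : M ^ 4 = 0 := by
    rw [show 4 = 2 + 2 from rfl, pow_add]
    exact matrix_mul_eq_zero_of_reduction_eq_zero hred2 hred2
  have hpow : (1 + M) ^ p = 1 := by
    rw [hM, add_sub_cancel, ← map_pow, ← ofAdd_nsmul]
    simp
  have := natCast_mul_eq_zero_of_one_add_pow_eq_one Fact.out hp
    ((natCast_mul_matrix_eq_zero_iff _).2 hred2) h4 hpow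
  rw [natCast_mul_matrix_eq_zero_iff, hred] at this
  simpa using congr_fun (congr_fun this 0) 1

/-- The nilpotent Jordan block of size four over `𝔽₃`. -/
def jordanBlockFour : Matrix (Fin 4) (Fin 4) (ZMod 3) :=
  !![0, 1, 0, 0; 0, 0, 1, 0; 0, 0, 0, 1; 0, 0, 0, 0]

lemma jordanBlockFour_pow_four : jordanBlockFour ^ 4 = 0 := by decide +kernel

lemma jordanBlockFour_pow_three : jordanBlockFour ^ 3 ≠ 0 := by decide +kernel

lemma exists_monoidHom_multiplicative_zmod {R : Type*} [Monoid R] {n : ℕ} {A : R}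
    (hn : 0 < n) (hA : A ^ n = 1) :
    ∃ f : Multiplicative (ZMod n) →* R, f (Multiplicative.ofAdd 1) = A := by
  let a : Rˣ := Units.ofPowEqOne A n hA hn.ne'
  have ha : a ^ n = 1 := Units.pow_ofPowEqOne hA hn.ne'
  refine ⟨(Units.coeHom R).comp (AddMonoidHom.toMultiplicativeLeft (ZMod.lift n
    ⟨zmultiplesHom (Additive Rˣ) (Additive.ofMul a), ?_⟩)), ?_⟩
  · simp [← ofMul_pow, ha]
  · have := ZMod.lift_coe n ⟨zmultiplesHom (Additive Rˣ) (Additive.ofMul a), by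
      simp [← ofMul_pow, ha]⟩ 1
    simp only [Int.cast_one] at this
    simp [this, a]

lemma not_hasPropertyL_multiplicative_zmod_nine :
    ¬ HasPropertyL 3 (Multiplicative (ZMod 9)) := by
  intro h
  have hJ : (1 + jordanBlockFour) ^ 9 = 1 := by decide +kernel
  obtain ⟨f, hf⟩ := exists_monoidHom_multiplicative_zmod (by norm_num) hJ
  obtain ⟨g, hg⟩ := h.exists_matrix_lift f
  set M := g (Multiplicative.ofAdd 1) - 1 with hM
  have hred : reductionMatrix 3 (ZMod 3) (Fin 4) M = jordanBlockFour := by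
    rw [hM, map_sub, hg, RingHom.map_one, hf, add_sub_cancel_left]
  have hred4 : reductionMatrix 3 (ZMod 3) (Fin 4) (M ^ 4) = 0 := by
    rw [map_pow, hred, jordanBlockFour_pow_four]
  have three : ∀ X : Matrix (Fin 4) (Fin 4) (W2 3 (ZMod 3)),
      3 * X = 0 ↔ reductionMatrix 3 (ZMod 3) (Fin 4) X = 0 := fun X => by
    exact_mod_cast natCast_mul_matrix_eq_zero_iff X
  have h9 : (9 : Matrix (Fin 4) (Fin 4) (W2 3 (ZMod 3))) = 0 := by
    rw [show (9 : Matrix (Fin 4) (Fin 4) (W2 3 (ZMod 3))) = 3 * 3 by norm_num, three, map_ofNat]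
    decide +kernel
  have h8 : M ^ 8 = 0 := by
    rw [show 8 = 4 + 4 from rfl, pow_add]
    exact matrix_mul_eq_zero_of_reduction_eq_zero hred4 hred4
  have hpow : (1 + M) ^ 9 = 1 := by
    rw [hM, add_sub_cancel, ← map_pow, ← ofAdd_nsmul,
      show (9 • (1 : ZMod 9)) = 0 by decide, ofAdd_zero, map_one]
  have := three_mul_pow_three_eq_zero_of_one_add_pow_eq_one h9 ((three _).2 hred4) h8 hpow
  rw [three, map_pow, hred] at this
  exact jordanBlockFour_pow_three this

lemma exists_galoisField_two_ne (p : ℕ) [Fact p.Prime] :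
    ∃ u : GaloisField p 2, u ≠ 0 ∧ u ≠ 1 ∧ u ≠ -1 := by
  classical
  by_contra! h
  have := Fintype.ofFinite (GaloisField p 2)
  have hsub : (Finset.univ : Finset (GaloisField p 2)) ⊆ {0, 1, -1} := fun u _ => by
    have := h u
    simp only [Finset.mem_insert, Finset.mem_singleton]
    tauto
  have h1 := (Finset.card_le_card hsub).trans Finset.card_le_three
  rw [Finset.card_univ, ← Nat.card_eq_fintype_card, GaloisField.card p 2 two_ne_zero] at h1
  nlinarith [(Fact.out : p.Prime).two_le]

variable {p : ℕ} [Fact p.Prime] {k : Type*} [Field k]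

lemma reduction_lift_unipotentHom {g : Multiplicative k →* Matrix (Fin 2) (Fin 2) (W2 p k)}
    (hg : ∀ x, reductionMatrix p k (Fin 2) (g x) = unipotentHom k x) (x : k) :
    reduction p k (g (Multiplicative.ofAdd x) 0 0) = 1 ∧
    reduction p k (g (Multiplicative.ofAdd x) 0 1) = x ∧
    reduction p k (g (Multiplicative.ofAdd x) 1 0) = 0 ∧
    reduction p k (g (Multiplicative.ofAdd x) 1 1) = 1 := by
  have h := fun i j => congr_fun (congr_fun (hg (Multiplicative.ofAdd x)) i) j
  exact ⟨h 0 0, h 0 1, h 1 0, h 1 1⟩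

/-- The upper right entry of `A ^ 2` is `A 0 1` times the trace, so the trace vanishes and
Cayley–Hamilton gives the determinant. -/
lemma det_eq_neg_one_of_sq_eq_one {R : Type*} [CommRing R] {A : Matrix (Fin 2) (Fin 2) R}
    (hA : A ^ 2 = 1) (hu : IsUnit (A 0 1)) : A.det = -1 := by
  have h00 := congr_fun (congr_fun hA 0) 0
  have h01 := congr_fun (congr_fun hA 0) 1
  simp only [sq, Matrix.mul_apply, Fin.sum_univ_two, Matrix.one_apply_eq] at h00
  simp only [sq, Matrix.mul_apply, Fin.sum_univ_two, ne_eq, zero_ne_one, not_false_eq_true,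
    Matrix.one_apply_ne] at h01
  have ht : A 0 0 + A 1 1 = 0 := hu.mul_right_eq_zero.1 (by linear_combination h01)
  rw [Matrix.det_fin_two]
  linear_combination A 0 0 * ht - h00

/-- All three nonidentity elements would have determinant `-1`, yet one is the product of the other
two; this forces `2 = 0` in `W2`. -/
lemma not_hasPropertyL_galoisField_two : ¬ HasPropertyL 2 (Multiplicative (GaloisField 2 2)) := by
  intro h
  obtain ⟨g, hg⟩ := h.exists_matrix_lift (unipotentHom (GaloisField 2 2))
  obtain ⟨u, hu0, hu1, hu2⟩ := exists_galoisField_two_ne 2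
  have key : ∀ x : GaloisField 2 2, x ≠ 0 → (g (Multiplicative.ofAdd x)).det = -1 := fun x hx =>
    det_eq_neg_one_of_sq_eq_one
      (by rw [← map_pow, ← ofAdd_nsmul, nsmul_eq_mul, CharP.cast_eq_zero, zero_mul, ofAdd_zero,
        map_one])
      (isUnit_of_reduction_ne_zero (by rwa [(reduction_lift_unipotentHom hg x).2.1]))
  have h1 := key 1 one_ne_zero
  have h2 := key u hu0
  have h3 := key (1 + u) (fun h => hu2 (by linear_combination h))
  rw [ofAdd_add, map_mul, Matrix.det_mul, h1, h2] at h3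
  have h4 := (natCast_mul_eq_zero_iff (p := 2) (k := GaloisField 2 2) 1).1 (by
    push_cast
    linear_combination h3)
  rw [map_one] at h4
  exact one_ne_zero h4

/-- The upper right entry of `A ^ 3` is `A 0 1` times `a² + ad + d² + A 0 1 * A 1 0`, with `a`, `d`
the diagonal entries. These are `1` plus kernel elements, so `a² + ad + d² = 3`. -/
lemma mul_eq_neg_three_of_pow_three_eq_one [CharP k 3] {A : Matrix (Fin 2) (Fin 2) (W2 3 k)}
    (hA : A ^ 3 = 1) (h00 : reduction 3 k (A 0 0) = 1)
    (h01 : reduction 3 k (A 0 1) ≠ 0) (h11 : reduction 3 k (A 1 1) = 1) :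
    A 0 1 * A 1 0 = -3 := by
  have hu := isUnit_of_reduction_ne_zero h01
  have h := congr_fun (congr_fun hA 0) 1
  simp only [pow_succ, pow_zero, one_mul, Matrix.mul_apply, Fin.sum_univ_two, ne_eq, zero_ne_one,
    not_false_eq_true, Matrix.one_apply_ne] at h
  have h' : A 0 0 * A 0 0 + A 0 0 * A 1 1 + A 1 1 * A 1 1 + A 0 1 * A 1 0 = 0 :=
    hu.mul_right_eq_zero.1 (by linear_combination h)
  have he : reduction 3 k (A 0 0 - 1) = 0 := by rw [map_sub, h00, map_one, sub_self]
  have hf : reduction 3 k (A 1 1 - 1) = 0 := by rw [map_sub, h11, map_one, sub_self]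
  have hee := mul_eq_zero_of_reduction_eq_zero he he
  have hef := mul_eq_zero_of_reduction_eq_zero he hf
  have hff := mul_eq_zero_of_reduction_eq_zero hf hf
  have h3e := (natCast_mul_eq_zero_iff _).2 he
  have h3f := (natCast_mul_eq_zero_iff _).2 hf
  push_cast at h3e h3f
  linear_combination h' - hee - hef - hff - h3e - h3f

/-- The lower left entry behaves additively, being in the kernel. Comparing the products of
off-diagonal entries for `1`, `u` and `1 + u` yields `1 + u + u² = 0`, that is `(u - 1)² = 0`, in
characteristic 3. -/
lemma not_hasPropertyL_galoisField_three :
    ¬ HasPropertyL 3 (Multiplicative (GaloisField 3 2)) := by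
  intro h
  obtain ⟨g, hg⟩ := h.exists_matrix_lift (unipotentHom (GaloisField 3 2))
  obtain ⟨u, hu0, hu1, hu2⟩ := exists_galoisField_two_ne 3
  have key : ∀ x : GaloisField 3 2, x ≠ 0 →
      g (Multiplicative.ofAdd x) 0 1 * g (Multiplicative.ofAdd x) 1 0 = -3 := fun x hx => by
    obtain ⟨h1, h2, -, h4⟩ := reduction_lift_unipotentHom hg x
    refine mul_eq_neg_three_of_pow_three_eq_one ?_ h1 (by rwa [h2]) h4
    rw [← map_pow, ← ofAdd_nsmul, nsmul_eq_mul, CharP.cast_eq_zero, zero_mul, ofAdd_zero, map_one]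
  have h1 := key 1 one_ne_zero
  have h2 := key u hu0
  have h3 := key (1 + u) (fun h => hu2 (by linear_combination h))
  obtain ⟨a00, a01, a10, a11⟩ := reduction_lift_unipotentHom hg 1
  obtain ⟨b00, b01, b10, b11⟩ := reduction_lift_unipotentHom hg u
  rw [ofAdd_add, map_mul] at h3
  simp only [Matrix.mul_apply, Fin.sum_univ_two] at h3
  generalize g (Multiplicative.ofAdd 1) = A at *
  generalize g (Multiplicative.ofAdd u) = B at *
  have prod : ∀ x y : W2 3 (GaloisField 3 2), reduction 3 _ x = 0 → reduction 3 _ y = 1 →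
      x * y = x := fun x y hx hy => by
    have := mul_eq_zero_of_reduction_eq_zero hx
      (show reduction 3 _ (y - 1) = 0 by rw [map_sub, hy, map_one, sub_self])
    linear_combination this
  have e1 := prod _ _ a10 b00
  have e2 := prod _ _ b10 a11
  have e3 := prod _ _ a10 b11
  have e4 := prod _ _ b10 b11
  have e5 := prod _ _ a10 a00
  have e6 := prod _ _ b10 a00
  have h4 : (A 0 1 + B 0 1) * (A 1 0 + B 1 0) = -3 := by
    linear_combination h3 - (A 0 0 * B 0 1 + A 0 1 * B 1 1) * (e1 + e2)
      - A 0 1 * (e3 + e4) - B 0 1 * (e5 + e6)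
  have h5 := (natCast_mul_eq_zero_iff (p := 3)
    (A 0 1 ^ 2 + A 0 1 * B 0 1 + B 0 1 ^ 2)).1 (by
      push_cast
      linear_combination A 0 1 ^ 2 * h2 + B 0 1 ^ 2 * h1 - A 0 1 * B 0 1 * (h4 - h1 - h2))
  simp only [map_add, map_mul, map_pow, a01, b01] at h5
  have three : (3 : GaloisField 3 2) = 0 := by exact_mod_cast CharP.cast_eq_zero (GaloisField 3 2) 3
  refine hu1 (sub_eq_zero.1 (pow_eq_zero_iff two_ne_zero |>.1 (?_ : (u - 1) ^ 2 = 0)))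
  linear_combination h5 - u * three

end Obstructions

/-! ### Lifting representations of cyclic groups through companion matrices -/

section CyclicLifting

open Polynomial

/-- The companion matrix of a polynomial `g` of degree `d`. -/
def companion {R : Type*} [Ring R] (g : R[X]) (d : ℕ) : Matrix (Fin d) (Fin d) R :=
  Matrix.of fun i j => if (j : ℕ) + 1 = d then -g.coeff i else if (i : ℕ) = j + 1 then 1 else 0

lemma leftMulMatrix_powerBasis_root {R : Type*} [CommRing R] [Nontrivial R] {g : R[X]}
    (hg : g.Monic) : Algebra.leftMulMatrix (AdjoinRoot.powerBasis' hg).basis (AdjoinRoot.root g) =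
      companion g g.natDegree := by
  have h := (AdjoinRoot.powerBasis' hg).leftMulMatrix
  have hmin : (AdjoinRoot.powerBasis' hg).minpolyGen = g := by
    rw [PowerBasis.minpolyGen_eq]
    refine (minpoly.unique' R _ hg (by simp) fun q hq => or_iff_not_imp_left.2 fun h0 hq0 => ?_).symm
    have := (AdjoinRoot.powerBasis' hg).dim_le_degree_of_root h0 hq0
    rw [AdjoinRoot.powerBasis'_dim, ← Polynomial.degree_eq_natDegree hg.ne_zero] at this
    exact absurd hq this.not_gt
  rw [hmin] at h
  exact h

lemma companion_pow_eq_one {R : Type*} [CommRing R] [Nontrivial R] {g : R[X]} (hg : g.Monic)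
    {d N : ℕ} (hd : g.natDegree = d) (hN : g ∣ X ^ N - 1) : companion g d ^ N = 1 := by
  subst hd
  have h : companion g g.natDegree ^ N =
      Algebra.leftMulMatrix (AdjoinRoot.powerBasis' hg).basis (AdjoinRoot.root g ^ N) := by
    rw [map_pow]
    exact congr_arg (· ^ N) (leftMulMatrix_powerBasis_root hg).symm
  have : AdjoinRoot.mk g (X ^ N - 1) = 0 := AdjoinRoot.mk_eq_zero.2 hN
  rw [map_sub, map_pow, AdjoinRoot.mk_X, map_one, sub_eq_zero] at this
  rw [h, this, map_one]
  rfl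

lemma companion_map {R S : Type*} [CommRing R] [CommRing S] (f : R →+* S) (g : R[X]) (d : ℕ) :
    f.mapMatrix (companion g d) = companion (g.map f) d := by
  ext i j
  simp only [companion, RingHom.mapMatrix_apply, Matrix.map_apply, Matrix.of_apply, coeff_map]
  split_ifs <;> simp

lemma exists_basis_quotient_span_X_smul {k : Type*} [Field k] {g : k[X]} (hg : g.Monic) {d : ℕ}
    (hd : g.natDegree = d) : ∃ b : Module.Basis (Fin d) k (k[X] ⧸ Ideal.span {g}),
      ∀ j, (X : k[X]) • b j = ∑ i, companion g d i j • b i := by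
  subst hd
  refine ⟨(AdjoinRoot.powerBasis' hg).basis, fun j => ?_⟩
  have h := fun i => Algebra.leftMulMatrix_eq_repr_mul (AdjoinRoot.powerBasis' hg).basis
    (AdjoinRoot.root g) i j
  rw [leftMulMatrix_powerBasis_root] at h
  have h2 := (AdjoinRoot.powerBasis' hg).basis.sum_repr
    (AdjoinRoot.root g * (AdjoinRoot.powerBasis' hg).basis j)
  simp only [← h] at h2
  exact h2.symm

lemma exists_basis_directSum_X_smul {k : Type*} [Field k] {ι : Type*} [Fintype ι] [DecidableEq ι]
    (g : ι → k[X]) (hg : ∀ i, (g i).Monic) (d : ι → ℕ) (hd : ∀ i, (g i).natDegree = d i) :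
    ∃ b : Module.Basis (Σ i, Fin (d i)) k (DirectSum ι fun i => k[X] ⧸ Ideal.span {g i}),
      ∀ s, (X : k[X]) • b s =
        ∑ t, Matrix.blockDiagonal' (fun i => companion (g i) (d i)) t s • b t := by
  choose b hb using fun i => exists_basis_quotient_span_X_smul (hg i) (hd i)
  refine ⟨DFinsupp.basis b, fun ⟨i, j⟩ => ?_⟩
  have hbs : ∀ i j, DFinsupp.basis b ⟨i, j⟩ =
      DirectSum.lof k ι (fun i => k[X] ⧸ Ideal.span {g i}) i (b i j) := fun i j => by
    change _ = DFinsupp.single (β := fun i => k[X] ⧸ Ideal.span {g i}) i (b i j)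
    rw [Module.Basis.apply_eq_iff]
    ext ⟨i', j'⟩
    by_cases h : i = i'
    · subst h
      simp [DFinsupp.basis, Finsupp.single_apply]
    · simp [DFinsupp.basis, h, Ne.symm h]
  rw [Fintype.sum_sigma, Finset.sum_eq_single i]
  · simp only [Matrix.blockDiagonal'_apply_eq, hbs]
    have hX := map_smul (DirectSum.lof k[X] ι (fun i => k[X] ⧸ Ideal.span {g i}) i) X (b i j)
    refine hX.symm.trans ?_
    rw [hb]
    exact (map_sum (DirectSum.lof k ι (fun i => k[X] ⧸ Ideal.span {g i}) i) _ _).trans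
      (Finset.sum_congr rfl fun l _ => map_smul _ _ _)
  · intro i' _ hi'
    refine Finset.sum_eq_zero fun j' _ => ?_
    rw [Matrix.blockDiagonal'_apply_ne _ _ _ hi', zero_smul]
  · simp

/-- An endomorphism of order dividing a power of the characteristic is a direct sum of companion
matrices of powers of `X - 1`. -/
lemma exists_basis_companion {p : ℕ} [Fact p.Prime] {k : Type u} [Field k] [CharP k p] {V : Type*}
    [AddCommGroup V] [Module k V] [Module.Finite k V] (φ : Module.End k V) {r : ℕ}
    (hφ : φ ^ p ^ r = 1) :
    ∃ (ι : Type u) (_ : Fintype ι) (_ : DecidableEq ι) (d : ι → ℕ) (_ : ∀ i, d i ≤ p ^ r)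
      (b : Module.Basis (Σ i, Fin (d i)) k V), ∀ s, φ (b s) =
        ∑ t, Matrix.blockDiagonal' (fun i => companion ((X - 1 : k[X]) ^ d i) (d i)) t s • b t := by
  classical
  have hmonic : (X - 1 : k[X]).Monic := by simpa using monic_X_sub_C (1 : k)
  have hprime : Prime (X - 1 : k[X]) := by simpa using prime_X_sub_C (1 : k)
  have hfrob : (X ^ p ^ r - 1 : k[X]) = (X - 1) ^ p ^ r := by
    rw [sub_pow_char_pow, one_pow]
  have hkill : ∀ m : Module.AEval' φ, ((X - 1) ^ p ^ r : k[X]) • m = 0 := fun m => by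
    obtain ⟨v, rfl⟩ := (Module.AEval'.of φ).surjective m
    rw [← hfrob, sub_smul, one_smul, Module.AEval'.X_pow_smul_of, hφ, one_smul, sub_self]
  have htors : Module.IsTorsion k[X] (Module.AEval' φ) := fun {m} =>
    ⟨⟨(X - 1) ^ p ^ r, mem_nonZeroDivisors_of_ne_zero (hmonic.pow _).ne_zero⟩, hkill m⟩
  obtain ⟨ι, hι, q, -, e, ⟨E⟩⟩ := Module.equiv_directSum_of_isTorsion htors
  have hdvd : ∀ i, q i ^ e i ∣ (X - 1) ^ p ^ r := fun i => by
    have h := congr_arg E (hkill (E.symm (DirectSum.lof k[X] ι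
      (fun i => k[X] ⧸ Submodule.span k[X] {q i ^ e i}) i (Submodule.Quotient.mk 1))))
    rw [map_smul, E.apply_symm_apply, map_zero, ← map_smul] at h
    have h2 := DFinsupp.single_injective (i := i) (h.trans (map_zero (DirectSum.lof k[X] ι
      (fun i => k[X] ⧸ Submodule.span k[X] {q i ^ e i}) i)).symm)
    rw [← Submodule.Quotient.mk_smul, Submodule.Quotient.mk_eq_zero, smul_eq_mul, mul_one] at h2
    exact Ideal.mem_span_singleton.1 h2
  choose d hd hassoc using fun i => (dvd_prime_pow hprime _).1 (hdvd i)
  have hspan : (fun i => Submodule.span k[X] {q i ^ e i}) =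
      fun i => Ideal.span {(X - 1 : k[X]) ^ d i} :=
    funext fun i => Ideal.span_singleton_eq_span_singleton.2 (hassoc i)
  -- The type of the direct sum depends on the family of ideals, so the equality `hspan` is
  -- transported through a linear equivalence.
  have hcast : ∀ S T : ι → Submodule k[X] k[X], S = T → Nonempty
      ((DirectSum ι fun i => k[X] ⧸ S i) ≃ₗ[k[X]] (DirectSum ι fun i => k[X] ⧸ T i)) := by
    rintro S T rfl
    exact ⟨LinearEquiv.refl _ _⟩
  obtain ⟨E'⟩ := hcast _ _ hspan
  obtain ⟨b, hb⟩ := exists_basis_directSum_X_smul (fun i => (X - 1 : k[X]) ^ d i)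
    (fun i => hmonic.pow _) d (fun i => by
      rw [natDegree_pow, ← C_1, natDegree_X_sub_C, mul_one])
  let F := E.trans E'
  refine ⟨ι, hι, inferInstance, d, hd,
    (b.map (F.symm.restrictScalars k)).map (Module.AEval'.of φ).symm, fun s => ?_⟩
  have h := congr_arg F.symm (hb s)
  rw [map_smul] at h
  apply (Module.AEval'.of φ).injective
  rw [← Module.AEval'.X_smul_of]
  simp only [Module.Basis.map_apply, LinearEquiv.apply_symm_apply, map_sum, map_smul]
  refine h.trans ((map_sum (F.symm.restrictScalars k) _ _).trans
    (Finset.sum_congr rfl fun t _ => map_smul (F.symm.restrictScalars k) _ _))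

variable {p : ℕ} [Fact p.Prime] {k : Type u} [Field k]

lemma exists_lift_companion {N : ℕ} {g : (W2 p k)[X]} (hg : g.Monic) (hN : g ∣ X ^ N - 1) {d : ℕ}
    (hgd : g.map (reduction p k) = (X - 1) ^ d) :
    ∃ B : Matrix (Fin d) (Fin d) (W2 p k), B ^ N = 1 ∧
      reductionMatrix p k _ B = companion ((X - 1) ^ d) d := by
  refine ⟨companion g d, companion_pow_eq_one hg ?_ hN, by rw [companion_map, hgd]⟩
  rw [← hg.natDegree_map (reduction p k), hgd, natDegree_pow, ← C_1, natDegree_X_sub_C, mul_one]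

variable [CharP k p]

lemma isUnit_of_reductionMatrix {ι : Type*} [Fintype ι] [DecidableEq ι]
    {A : Matrix ι ι (W2 p k)} (hA : IsUnit (reductionMatrix p k ι A)) : IsUnit A := by
  rw [Matrix.isUnit_iff_isUnit_det] at hA ⊢
  refine isUnit_of_reduction_ne_zero ?_
  rw [RingHom.map_det]
  exact hA.ne_zero

/-- If each `(X - 1) ^ d` with `d ≤ p ^ r` lifts to a monic divisor of `X ^ (p ^ r) - 1`, then
each matrix of order dividing `p ^ r` lifts to such a matrix. -/
lemma exists_lift_of_pow_eq_one {r : ℕ} (H : ∀ d ≤ p ^ r, ∃ g : (W2 p k)[X], g.Monic ∧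
      g ∣ X ^ p ^ r - 1 ∧ g.map (reduction p k) = (X - 1) ^ d) {n : ℕ}
    (A : Matrix (Fin n) (Fin n) k) (hA : A ^ p ^ r = 1) :
    ∃ B : Matrix (Fin n) (Fin n) (W2 p k), B ^ p ^ r = 1 ∧ reductionMatrix p k _ B = A := by
  obtain ⟨ι, _, _, d, hd, b, hb⟩ := exists_basis_companion (Matrix.toLinAlgEquiv' A)
    (by rw [← map_pow, hA, map_one] : Matrix.toLinAlgEquiv' A ^ p ^ r = 1)
  choose g hg hgN hgd using fun i => H (d i) (hd i)
  choose B hBN hB using fun i => exists_lift_companion (hg i) (hgN i) (hgd i)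
  set D := Matrix.blockDiagonal' (fun i => companion ((X - 1 : k[X]) ^ d i) (d i)) with hD
  have hDlift : reductionMatrix p k _ (Matrix.blockDiagonal' B) = D := by
    rw [RingHom.mapMatrix_apply, Matrix.blockDiagonal'_map _ _ (map_zero _), hD]
    congr 1
    exact funext hB
  have hDN : Matrix.blockDiagonal' B ^ p ^ r = 1 := by
    rw [← Matrix.blockDiagonal'_pow, ← Matrix.blockDiagonal'_one]
    congr 1
    exact funext hBN
  let σ : (Σ i, Fin (d i)) ≃ Fin n := b.indexEquiv (Pi.basisFun k (Fin n))
  let P : Matrix (Fin n) (Fin n) k := (Pi.basisFun k (Fin n)).toMatrix (b.reindex σ)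
  have hP : IsUnit P := by
    have := (Pi.basisFun k (Fin n)).invertibleToMatrix (b.reindex σ)
    exact isUnit_of_invertible P
  have hAP : A * P = P * D.submatrix σ.symm σ.symm := by
    ext i j
    have h := congr_fun (hb (σ.symm j)) i
    rw [← σ.symm.sum_comp] at h
    simpa [P, Matrix.mul_apply, Module.Basis.toMatrix_apply, Matrix.mulVec, dotProduct,
      mul_comm] using h
  -- Any lift of the change of basis is invertible, so conjugating the block lift by it preserves
  -- the order relation.
  obtain ⟨Q, hQ⟩ := reductionMatrix_surjective (p := p) P
  have hQu : IsUnit Q := isUnit_of_reductionMatrix (by rwa [hQ])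
  obtain ⟨Q, rfl⟩ := hQu
  set D' := Matrix.reindexAlgEquiv (W2 p k) (W2 p k) σ (Matrix.blockDiagonal' B) with hD'
  refine ⟨Q * D' * Q⁻¹.val, ?_, ?_⟩
  · rw [Units.conj_pow, hD', ← map_pow, hDN, map_one, mul_one, Units.mul_inv]
  · have h1 : reductionMatrix p k _ D' = D.submatrix σ.symm σ.symm := by
      rw [← hDlift]
      rfl
    rw [map_mul, map_mul, hQ, h1, ← hAP, ← hQ, mul_assoc, ← map_mul, Units.mul_inv]
    simp

lemma hasPropertyL_multiplicative_zmod {p : ℕ} [Fact p.Prime] {r : ℕ}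
    (H : ∀ (k : Type) [Field k] [CharP k p], ∀ d ≤ p ^ r, ∃ g : (W2 p k)[X], g.Monic ∧
      g ∣ X ^ p ^ r - 1 ∧ g.map (reduction p k) = (X - 1) ^ d) :
    HasPropertyL p (Multiplicative (ZMod (p ^ r))) := by
  have hpos : 0 < p ^ r := pow_pos (Fact.out : p.Prime).pos r
  refine hasPropertyL_of_matrix_lift fun k _ _ _ n f => ?_
  obtain ⟨B, hBN, hB⟩ := exists_lift_of_pow_eq_one (H k) (f (Multiplicative.ofAdd 1)) (by
    rw [← map_pow, ← ofAdd_nsmul, nsmul_eq_mul, mul_one, ZMod.natCast_self, ofAdd_zero, map_one])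
  obtain ⟨g, hg⟩ := exists_monoidHom_multiplicative_zmod hpos hBN
  refine ⟨g, fun x => ?_⟩
  obtain ⟨m, hm⟩ : ∃ m : ℕ, x = Multiplicative.ofAdd 1 ^ m := by
    have : NeZero (p ^ r) := ⟨hpos.ne'⟩
    refine ⟨x.toAdd.val, ?_⟩
    rw [← ofAdd_nsmul, nsmul_eq_mul, mul_one, ZMod.natCast_zmod_val, ofAdd_toAdd]
  rw [hm, map_pow, map_pow, map_pow, hg, hB]

/-- The factors `X - 1` and `X ^ 2 ^ i + 1` for `i < r` reduce to powers of `X - 1`; their degrees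
`1, 1, 2, 4, …` have subset sums covering all `d ≤ 2 ^ r`. -/
lemma exists_monic_dvd_X_pow_two_pow_sub_one {R k : Type*} [CommRing R] [Nontrivial R] [Field k]
    [CharP k 2] (f : R →+* k) (r : ℕ) : ∀ d ≤ 2 ^ r, ∃ g : R[X], g.Monic ∧ g ∣ X ^ 2 ^ r - 1 ∧
      g.map f = (X - 1) ^ d := by
  induction r with
  | zero =>
    intro d hd
    rw [pow_zero] at hd
    interval_cases d
    · exact ⟨1, monic_one, one_dvd _, by simp⟩
    · exact ⟨X - 1, by simpa using monic_X_sub_C (1 : R), by simp, by simp⟩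
  | succ r ih =>
    intro d hd
    have hfac : (X ^ 2 ^ (r + 1) - 1 : R[X]) = (X ^ 2 ^ r - 1) * (X ^ 2 ^ r + 1) := by ring
    rcases le_or_gt d (2 ^ r) with h | h
    · obtain ⟨g, hg, hdvd, hgd⟩ := ih d h
      exact ⟨g, hg, hfac ▸ hdvd.mul_right _, hgd⟩
    · obtain ⟨g, hg, hdvd, hgd⟩ := ih (d - 2 ^ r) (by rw [pow_succ] at hd; lia)
      refine ⟨g * (X ^ 2 ^ r + 1), hg.mul ?_, hfac ▸ mul_dvd_mul_right hdvd _, ?_⟩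
      · simpa using monic_X_pow_add_C (1 : R) (pow_pos two_pos r).ne'
      · have h2 : (X ^ 2 ^ r + 1 : k[X]) = (X - 1) ^ 2 ^ r := by
          rw [sub_pow_char_pow, one_pow, CharTwo.sub_eq_add]
        rw [Polynomial.map_mul, hgd, Polynomial.map_add, Polynomial.map_pow, map_X,
          Polynomial.map_one, h2, ← pow_add, Nat.sub_add_cancel h.le]

lemma exists_monic_dvd_X_pow_three_sub_one {R k : Type*} [CommRing R] [Nontrivial R] [Field k]
    [CharP k 3] (f : R →+* k) : ∀ d ≤ 3, ∃ g : R[X], g.Monic ∧ g ∣ X ^ 3 - 1 ∧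
      g.map f = (X - 1) ^ d := by
  have hX : (X - 1 : R[X]).Monic := by simpa using monic_X_sub_C (1 : R)
  have hX3 : (X ^ 3 - 1 : R[X]).Monic := by
    simpa using monic_X_pow_sub_C (1 : R) (n := 3) three_ne_zero
  have hfac : (X ^ 3 - 1 : R[X]) = (X - 1) * (X ^ 2 + X + 1) := by ring
  have three : (3 : k[X]) = 0 := by exact_mod_cast CharP.cast_eq_zero k[X] 3
  intro d hd
  interval_cases d
  · exact ⟨1, monic_one, one_dvd _, by simp⟩
  · exact ⟨X - 1, hX, ⟨_, hfac⟩, by simp⟩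
  · refine ⟨X ^ 2 + X + 1, hX.of_mul_monic_left (hfac ▸ hX3), ⟨X - 1, by rw [hfac, mul_comm]⟩, ?_⟩
    simp only [Polynomial.map_add, Polynomial.map_pow, map_X, Polynomial.map_one]
    linear_combination X * three
  · refine ⟨X ^ 3 - 1, hX3, dvd_rfl, ?_⟩
    simp only [Polynomial.map_sub, Polynomial.map_pow, map_X, Polynomial.map_one]
    linear_combination (X ^ 2 - X) * three

lemma hasPropertyL_two_multiplicative_zmod (n : ℕ) :
    HasPropertyL 2 (Multiplicative (ZMod (2 ^ n))) :=
  hasPropertyL_multiplicative_zmod fun k _ _ =>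
    exists_monic_dvd_X_pow_two_pow_sub_one (reduction 2 k) n

lemma hasPropertyL_three_multiplicative_zmod : HasPropertyL 3 (Multiplicative (ZMod 3)) :=
  hasPropertyL_multiplicative_zmod (p := 3) (r := 1) fun k _ _ =>
    exists_monic_dvd_X_pow_three_sub_one (reduction 3 k)

end CyclicLifting

/-! ### Structure of 2-groups with at most one involution -/

section UniqueInvolution

variable {G : Type*} [Group G]

lemma exists_pow_two_pow_notMem (hG : IsPGroup 2 G) (H : Subgroup G) {g : G} (hg : g ∉ H) :
    ∃ j, g ^ 2 ^ j ∉ H ∧ (g ^ 2 ^ j) ^ 2 ∈ H := by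
  classical
  have hex : ∃ k, g ^ 2 ^ k ∈ H := by
    obtain ⟨k, hk⟩ := hG g
    exact ⟨k, hk ▸ H.one_mem⟩
  obtain ⟨j, hj⟩ : ∃ j, Nat.find hex = j + 1 := Nat.exists_eq_succ_of_ne_zero fun h => by
    have := Nat.find_spec hex
    rw [h, pow_zero, pow_one] at this
    exact hg this
  refine ⟨j, Nat.find_min hex (by lia), ?_⟩
  have := Nat.find_spec hex
  rwa [hj, pow_succ, pow_mul] at this

lemma exists_sq_eq_one_of_ne_bot (hG : IsPGroup 2 G) {H : Subgroup G} (hH : H ≠ ⊥) :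
    ∃ z ∈ H, z ^ 2 = 1 ∧ z ≠ 1 := by
  obtain ⟨h, hh, h1⟩ := H.bot_or_exists_ne_one.resolve_left hH
  obtain ⟨j, hj1, hj2⟩ := exists_pow_two_pow_notMem hG ⊥ (g := h) (by simpa using h1)
  exact ⟨h ^ 2 ^ j, H.pow_mem hh _, by simpa using hj2, by simpa using hj1⟩

lemma mem_zpowers_zpow_of_odd (hG : IsPGroup 2 G) (a : G) {i : ℤ} (hi : Odd i) :
    a ∈ Subgroup.zpowers (a ^ i) := by
  obtain ⟨s, hs⟩ := hG a
  have hcop : IsCoprime i ((2 : ℤ) ^ s) := by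
    obtain ⟨m, rfl⟩ := hi
    exact IsCoprime.pow_right ⟨1, -m, by ring⟩
  obtain ⟨u, v, huv⟩ := hcop
  refine ⟨u, ?_⟩
  have hs' : a ^ ((2 : ℤ) ^ s) = 1 := by exact_mod_cast hs
  calc (a ^ i) ^ u = a ^ (u * i) * (a ^ ((2 : ℤ) ^ s)) ^ v := by
        rw [hs', one_zpow, mul_one, ← zpow_mul, mul_comm]
    _ = a := by rw [← zpow_mul, mul_comm _ v, ← zpow_add, huv, zpow_one]

variable (hG : IsPGroup 2 G)
  (hU : ∀ x y : G, x ^ 2 = 1 → x ≠ 1 → y ^ 2 = 1 → y ≠ 1 → x = y)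

include hG hU

lemma mem_of_sq_eq_one {H : Subgroup G} (hH : H ≠ ⊥) {x : G} (hx : x ^ 2 = 1) : x ∈ H := by
  obtain ⟨z, hz, hz2, hz1⟩ := exists_sq_eq_one_of_ne_bot hG hH
  by_cases h : x = 1
  · exact h ▸ H.one_mem
  · exact hU x z hx h hz2 hz1 ▸ hz

/-- Take `a` of maximal order and `y` outside its span with `y ^ 2 = a ^ i`. For even `i`, `y` times
a power of `a` squares to `1`, hence lies in the span; for odd `i`, `y` generates a larger cyclic
group. -/
lemma exists_zpowers_eq_of_commutative [Finite G] (A : Subgroup G)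
    (hA : ∀ x ∈ A, ∀ y ∈ A, x * y = y * x) : ∃ a, Subgroup.zpowers a = A := by
  obtain ⟨a, ha, hmax⟩ := Set.exists_max_image (A : Set G) orderOf (Set.toFinite _) ⟨1, A.one_mem⟩
  refine ⟨a, le_antisymm ((Subgroup.zpowers_le).2 ha) fun x hx => ?_⟩
  by_contra hxa
  obtain ⟨j, hy, hy2⟩ := exists_pow_two_pow_notMem hG _ hxa
  have hyA : x ^ 2 ^ j ∈ A := A.pow_mem hx _
  generalize x ^ 2 ^ j = y at hy hy2 hyA
  obtain ⟨i, hi⟩ := hy2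
  change a ^ i = y ^ 2 at hi
  have hcomm : Commute y a := hA y hyA a ha
  rcases Int.even_or_odd i with ⟨l, rfl⟩ | hodd
  · have h1 : (y * a ^ (-l)) ^ 2 = 1 := by
      rw [(hcomm.zpow_right (-l)).mul_pow, ← hi, ← zpow_natCast (a ^ (-l)), ← zpow_mul, ← zpow_add]
      rw [show l + l + -l * ((2 : ℕ) : ℤ) = 0 by push_cast; ring, zpow_zero]
    have hbot : Subgroup.zpowers a ≠ ⊥ := by
      rw [Ne, Subgroup.zpowers_eq_bot]
      rintro rfl
      have h := hmax y hyA
      rw [orderOf_one] at h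
      have h' := orderOf_pos y
      rw [orderOf_eq_one_iff.1 (by lia : orderOf y = 1)] at hy
      exact hy (Subgroup.one_mem _)
    have h2 := mem_of_sq_eq_one hG hU hbot h1
    exact hy ((Subgroup.mul_mem_cancel_right _ (Subgroup.zpow_mem _
      (Subgroup.mem_zpowers a) _)).1 h2)
  · have h1 := mem_zpowers_zpow_of_odd hG a hodd
    rw [hi] at h1
    have h2 : Subgroup.zpowers a ≤ Subgroup.zpowers y := Subgroup.zpowers_le.2
      (Subgroup.zpowers_le.2 (Subgroup.pow_mem _ (Subgroup.mem_zpowers y) 2) h1)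
    have h3 := Subgroup.eq_of_le_of_card_ge h2 (by
      rw [Nat.card_zpowers, Nat.card_zpowers]; exact hmax y hyA)
    exact hy (h3 ▸ Subgroup.mem_zpowers y)

omit hU in
-- Otherwise the image of the centralizer is a nontrivial normal subgroup of the 2-group `G ⧸ A`, so
-- it contains a nontrivial central element; adjoining a preimage to `A` gives a larger abelian
-- normal subgroup.
lemma centralizer_le_of_maximal [Finite G] {A : Subgroup G} [hAn : A.Normal]
    (hA : ∀ x ∈ A, ∀ y ∈ A, x * y = y * x)
    (hmax : ∀ B : Subgroup G, B.Normal → (∀ x ∈ B, ∀ y ∈ B, x * y = y * x) → A ≤ B → B ≤ A) :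
    Subgroup.centralizer (A : Set G) ≤ A := by
  by_contra hC
  obtain ⟨c, hc, hcA⟩ := SetLike.not_le_iff_exists.1 hC
  set C := (Subgroup.centralizer (A : Set G)).map (QuotientGroup.mk' A) with hCdef
  have hCn : C.Normal := Subgroup.Normal.map inferInstance _ (QuotientGroup.mk'_surjective A)
  have hCne : Nat.card C ≠ 1 := fun h => by
    have := Subgroup.mem_map_of_mem (QuotientGroup.mk' A) hc
    rw [← hCdef, Subgroup.eq_bot_of_card_eq C h, Subgroup.mem_bot, QuotientGroup.mk'_apply,
      QuotientGroup.eq_one_iff] at this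
    exact hcA this
  have hQ : IsPGroup 2 (G ⧸ A) := hG.to_quotient A
  let _ : MulAction (G ⧸ A) C := MulAction.compHom C (MulAut.conjNormal : G ⧸ A →* MulAut C)
  obtain ⟨⟨b, hbC⟩, hb, hb1⟩ := hQ.exists_fixed_point_of_prime_dvd_card_of_fixed_point C
    ((hQ.to_subgroup C).card_eq_or_dvd.resolve_left hCne) (a := 1)
    fun g => map_one (MulAut.conjNormal g)
  obtain ⟨x, hx, rfl⟩ := hbC
  have hxA : x ∉ A := fun h => hb1 (Subtype.ext ((QuotientGroup.eq_one_iff x).2 h).symm)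
  have hcentral : (x : G ⧸ A) ∈ Subgroup.center (G ⧸ A) := by
    rw [Subgroup.mem_center_iff]
    intro g
    have := congr_arg Subtype.val (hb g)
    exact mul_inv_eq_iff_eq_mul.1 this
  set B := (Subgroup.zpowers (x : G ⧸ A)).comap (QuotientGroup.mk' A) with hB
  have hBn : B.Normal := by
    have : (Subgroup.zpowers (x : G ⧸ A)).Normal := ⟨fun n hn g => by
      have := Subgroup.mem_center_iff.1 ((Subgroup.zpowers_le.2 hcentral) hn) g
      rwa [this, mul_inv_cancel_right]⟩
    exact this.comap _
  have hxB : x ∈ B := Subgroup.mem_zpowers (x : G ⧸ A)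
  have hdec : ∀ y ∈ B, ∃ a ∈ A, ∃ i : ℤ, y = a * x ^ i := by
    rintro y ⟨i, hi⟩
    refine ⟨y * (x ^ i)⁻¹, ?_, i, by group⟩
    rw [← QuotientGroup.eq_one_iff, QuotientGroup.mk_mul, QuotientGroup.mk_inv,
      QuotientGroup.mk_zpow, mul_inv_eq_one]
    exact hi.symm
  refine hxA (hmax B hBn ?_ (fun a ha => ?_) hxB)
  · intro y hy w hw
    obtain ⟨a, ha, i, rfl⟩ := hdec y hy
    obtain ⟨b, hb, j, rfl⟩ := hdec w hw
    have hax : ∀ a ∈ A, Commute a x := fun a ha => hx a ha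
    have hab : Commute a b := hA a ha b hb
    exact ((hab.mul_right ((hax a ha).zpow_right j))).mul_left
      ((((hax b hb).zpow_right i).symm).mul_right ((Commute.refl x).zpow_zpow i j))
  · change ((a : G ⧸ A)) ∈ Subgroup.zpowers (x : G ⧸ A)
    rw [(QuotientGroup.eq_one_iff a).2 ha]
    exact Subgroup.one_mem _

/-- An element outside a cyclic self-centralizing normal subgroup whose square lies in it inverts
that subgroup. -/
lemma conj_eq_inv_of_sq_mem [Finite G] {a : G} [hAn : (Subgroup.zpowers a).Normal]
    (hC : Subgroup.centralizer (Subgroup.zpowers a : Set G) ≤ Subgroup.zpowers a) {g : G}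
    (hg : g ∉ Subgroup.zpowers a) (hg2 : g ^ 2 ∈ Subgroup.zpowers a) : g * a * g⁻¹ = a⁻¹ := by
  set A := Subgroup.zpowers a with hAdef
  have haA : a ∈ A := Subgroup.mem_zpowers a
  have hA : ∀ x ∈ A, ∀ y ∈ A, x * y = y * x := by
    rintro _ ⟨i, rfl⟩ _ ⟨j, rfl⟩
    exact (Commute.refl a).zpow_zpow i j
  have hbot : A ≠ ⊥ := by
    intro h
    refine hg (hC fun y hy => ?_)
    have : y = 1 := by simpa [h] using hy
    simp [this]
  have hga : g * a ≠ a * g := fun h => hg (hC fun y hy => by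
    obtain ⟨i, rfl⟩ := hy
    exact ((show Commute a g from h.symm).zpow_left i))
  -- The expression is `(y * g) ^ 2`, while `y * g` lies outside `A`, which contains every solution
  -- of `x ^ 2 = 1`.
  have hsq : ∀ y ∈ A, y * (g * y * g⁻¹) * g ^ 2 ≠ 1 := fun y hy h => by
    refine hg ((A.mul_mem_cancel_left hy).1 (mem_of_sq_eq_one hG hU hbot (x := y * g) ?_))
    rw [← h, sq]; group
  obtain ⟨c, hc⟩ := exists_zpowers_eq_of_commutative hG hU (A ⊓ Subgroup.centralizer {g})
    fun x hx y hy => hA x hx.1 y hy.1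
  have hcmem : c ∈ A ⊓ Subgroup.centralizer {g} := hc ▸ Subgroup.mem_zpowers c
  have hcA : c ∈ A := hcmem.1
  have hcg : Commute g c := Subgroup.mem_centralizer_iff.1 hcmem.2 g rfl
  have hmem : ∀ y ∈ A, Commute g y → ∃ i : ℤ, y = c ^ i := fun y hy hyg => by
    have : y ∈ Subgroup.zpowers c := by
      rw [hc]
      exact ⟨hy, Subgroup.mem_centralizer_iff.2 fun w hw => by rw [hw]; exact hyg⟩
    exact this.imp fun i hi => hi.symm
  have hconj : ∀ i : ℤ, g * c ^ i * g⁻¹ = c ^ i := fun i => by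
    rw [(hcg.zpow_right i).eq, mul_inv_cancel_right]
  obtain ⟨i, hi⟩ := hmem _ hg2 (Commute.self_pow g 2)
  have hiodd : Odd i := by
    rw [← Int.not_even_iff_odd]
    rintro ⟨l, rfl⟩
    refine hsq (c ^ (-l)) (A.zpow_mem hcA _) ?_
    rw [hconj, hi, ← zpow_add, ← zpow_add]
    rw [show -l + -l + (l + l) = 0 by ring, zpow_zero]
  have hcaA : g * a * g⁻¹ ∈ A := hAn.conj_mem a haA g
  have hN : Commute g (a * (g * a * g⁻¹)) := by
    have h1 : g ^ 2 * a = a * g ^ 2 := hA _ hg2 _ haA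
    have h2 : a * (g * a * g⁻¹) = g * a * g⁻¹ * a := hA _ haA _ hcaA
    calc g * (a * (g * a * g⁻¹)) = g * a * g⁻¹ * (g ^ 2 * a) * g⁻¹ := by group
      _ = g * a * g⁻¹ * a * g := by rw [h1]; group
      _ = a * (g * a * g⁻¹) * g := by rw [h2]
  obtain ⟨j, hj⟩ := hmem _ (A.mul_mem haA hcaA) hN
  have hNc : ∀ l : ℤ, a * c ^ l * (g * (a * c ^ l) * g⁻¹) = c ^ (j + l + l) := fun l => by
    have h1 : g * (a * c ^ l) * g⁻¹ = g * a * g⁻¹ * c ^ l := by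
      nth_rw 2 [← hconj l]; group
    rw [h1, zpow_add, zpow_add, ← hj]
    have h2 : c ^ l * (g * a * g⁻¹) = g * a * g⁻¹ * c ^ l := hA _ (A.zpow_mem hcA l) _ hcaA
    calc a * c ^ l * (g * a * g⁻¹ * c ^ l) = a * (c ^ l * (g * a * g⁻¹)) * c ^ l := by group
      _ = a * (g * a * g⁻¹) * c ^ l * c ^ l := by rw [h2]; group
  -- Were `j` odd, `i + j = 2 * l` would be even and `a * c ^ (-l)` would contradict `hsq`.
  have hjeven : Even j := by
    rw [← Int.not_odd_iff_even]
    intro hjodd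
    obtain ⟨l, hl⟩ := hjodd.add_odd hiodd
    refine hsq (a * c ^ (-l)) (A.mul_mem haA (A.zpow_mem hcA _)) ?_
    rw [hNc, hi, ← zpow_add]
    rw [show j + -l + -l + i = 0 by lia, zpow_zero]
  obtain ⟨l, hl⟩ := hjeven
  have hinv : a * c ^ (-l) * (g * (a * c ^ (-l)) * g⁻¹) = 1 := by
    rw [hNc, hl]
    rw [show l + l + -l + -l = 0 by ring, zpow_zero]
  obtain ⟨t, ht⟩ := A.zpow_mem hcA (-l)
  change a ^ t = c ^ (-l) at ht
  -- The element `a * c ^ (-l) = a ^ (1 + t)` is inverted by `g`, while `a ^ t` is fixed. The odd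
  -- one of the two exponents gives a generator of `A`, and fixing a generator is excluded.
  rcases Int.even_or_odd t with hte | hto
  · have hodd : Odd (1 + t) := odd_one.add_even hte
    rw [← ht, ← zpow_one_add] at hinv
    obtain ⟨s, hs⟩ := mem_zpowers_zpow_of_odd hG a hodd
    change (a ^ (1 + t)) ^ s = a at hs
    have h := eq_inv_of_mul_eq_one_right hinv
    calc g * a * g⁻¹ = (g * a ^ (1 + t) * g⁻¹) ^ s := by rw [conj_zpow, hs]
      _ = a⁻¹ := by rw [h, inv_zpow, hs]
  · refine absurd ?_ hga
    obtain ⟨s, hs⟩ := mem_zpowers_zpow_of_odd hG a hto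
    change (a ^ t) ^ s = a at hs
    rw [ht] at hs
    have := (hcg.zpow_right (-l)).zpow_right s
    rw [hs] at this
    exact this

/-- If not, some square `r ^ 2` inverts `a`, so `r` acts by an exponent `u` with `u² ≡ -1` modulo
the order of `a`; that order is divisible by 4, where `-1` is not a square. -/
lemma sq_mem_of_notMem [Finite G] {a : G} [hAn : (Subgroup.zpowers a).Normal]
    (hC : Subgroup.centralizer (Subgroup.zpowers a : Set G) ≤ Subgroup.zpowers a) {g : G}
    (hg : g ∉ Subgroup.zpowers a) : g ^ 2 ∈ Subgroup.zpowers a := by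
  obtain ⟨j, hj, hj2⟩ := exists_pow_two_pow_notMem hG _ hg
  have hinv := conj_eq_inv_of_sq_mem hG hU hC hj hj2
  cases j with
  | zero => simpa using hj2
  | succ j =>
    exfalso
    rw [pow_succ, pow_mul] at hinv hj
    generalize g ^ 2 ^ j = r at hinv hj
    obtain ⟨u, hu⟩ := hAn.conj_mem a (Subgroup.mem_zpowers a) r
    change a ^ u = r * a * r⁻¹ at hu
    have h1 : a ^ (u * u + 1) = 1 := by
      rw [zpow_add_one, zpow_mul, hu, conj_zpow, hu]
      rw [← mul_eq_one_iff_eq_inv] at hinv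
      rw [← hinv, sq]; group
    have h2 : a ^ 2 ≠ 1 := fun h => by
      have ha : a⁻¹ = a := inv_eq_of_mul_eq_one_left (by rw [← sq, h])
      rw [ha, mul_inv_eq_iff_eq_mul] at hinv
      refine hj (hC fun y hy => ?_)
      obtain ⟨i, rfl⟩ := hy
      exact ((show Commute a (r ^ 2) from hinv.symm).zpow_left i)
    obtain ⟨s, hs⟩ := (IsPGroup.iff_orderOf.1 hG) a
    have h4 : (4 : ℤ) ∣ orderOf a := by
      rcases Nat.lt_or_ge s 2 with h | h
      · refine absurd (orderOf_dvd_iff_pow_eq_one.1 ?_) h2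
        rw [hs]
        exact pow_dvd_pow 2 (by lia : s ≤ 1)
      · rw [hs]
        exact_mod_cast pow_dvd_pow 2 h
    have h5 := h4.trans (orderOf_dvd_iff_zpow_eq_one.2 h1)
    rcases Int.even_or_odd' u with ⟨v, rfl | rfl⟩
    · ring_nf at h5; lia
    · ring_nf at h5; lia

end UniqueInvolution

/-! ### Quaternion recognition and the classification of groups with property `L_p` -/

section Classification

variable {G : Type*} [Group G]

open QuaternionGroup in
lemma exists_mulEquiv_quaternionGroup {n : ℕ} [NeZero n] {a g : G} (ha : orderOf a = 2 * n)
    (hga : g * a * g⁻¹ = a⁻¹) (hg2 : g ^ 2 = a ^ n) (hg : g ∉ Subgroup.zpowers a)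
    (htop : ∀ x ∉ Subgroup.zpowers a, g⁻¹ * x ∈ Subgroup.zpowers a) :
    Nonempty (G ≃* QuaternionGroup n) := by
  have hpos : 0 < 2 * n := Nat.mul_pos two_pos (NeZero.pos n)
  have : NeZero (2 * n) := ⟨hpos.ne'⟩
  obtain ⟨e, he⟩ := LiftableGroups.exists_monoidHom_multiplicative_zmod hpos
    (ha ▸ pow_orderOf_eq_one a : a ^ (2 * n) = 1)
  let E : ZMod (2 * n) → G := fun i => e (Multiplicative.ofAdd i)
  have hE : ∀ i : ZMod (2 * n), E i = a ^ i.val := fun i => by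
    rw [← he, ← map_pow, ← ofAdd_nsmul, nsmul_eq_mul, mul_one, ZMod.natCast_zmod_val]
  have hEadd : ∀ i j, E (i + j) = E i * E j := fun i j => by simp only [E, ofAdd_add, map_mul]
  have hEneg : ∀ i, E (-i) = (E i)⁻¹ := fun i => by simp only [E, ofAdd_neg, map_inv]
  have hEn : E n = g ^ 2 := by
    rw [hg2, hE, ZMod.val_natCast_of_lt (by have := NeZero.pos n; lia)]
  have hEmem : ∀ i, E i ∈ Subgroup.zpowers a := fun i => by
    rw [hE]; exact Subgroup.pow_mem _ (Subgroup.mem_zpowers a) _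
  have hEsurj : ∀ x ∈ Subgroup.zpowers a, ∃ i, E i = x := by
    rintro _ ⟨t, rfl⟩
    exact ⟨(Multiplicative.ofAdd (1 : ZMod (2 * n)) ^ t).toAdd, by
      simp only [E, ofAdd_toAdd, map_zpow, he]⟩
  have hEinj : ∀ i, E i = 1 → i = 0 := fun i hi => by
    rw [hE, ← orderOf_dvd_iff_pow_eq_one, ha] at hi
    exact (ZMod.val_eq_zero i).1 (Nat.eq_zero_of_dvd_of_lt hi (ZMod.val_lt i))
  have hconj : ∀ i, E i * g = g * (E i)⁻¹ := fun i => by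
    have h : g * E i * g⁻¹ = (E i)⁻¹ := by rw [hE, ← conj_pow, hga, inv_pow]
    rw [eq_mul_inv_iff_mul_eq]
    calc E i * g * E i = E i * (g * E i * g⁻¹) * g := by group
      _ = g := by rw [h, mul_inv_cancel, one_mul]
  let ψ : QuaternionGroup n →* G := MonoidHom.mk' (fun x => match x with
    | .a i => E i
    | .xa i => g * E i) (by
      rintro (i | i) (j | j)
      · exact hEadd i j
      · change g * E (j - i) = E i * (g * E j)
        rw [sub_eq_add_neg, add_comm, hEadd, hEneg, ← mul_assoc, ← hconj, mul_assoc]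
      · change g * E (i + j) = g * E i * E j
        rw [hEadd, mul_assoc]
      · change E (n + j - i) = g * E i * (g * E j)
        rw [sub_eq_add_neg, add_assoc, add_comm j, hEadd, hEadd, hEneg, hEn]
        calc g ^ 2 * ((E i)⁻¹ * E j)
            = g * (g * (E i)⁻¹) * E j := by rw [sq]; group
          _ = g * E i * (g * E j) := by rw [← hconj]; group)
  have hψ : Function.Bijective ψ := by
    constructor
    · rw [injective_iff_map_eq_one]
      rintro (i | i) hi
      · change E i = 1 at hi
        rw [hEinj i hi]; rfl
      · change g * E i = 1 at hi
        rw [eq_inv_of_mul_eq_one_left hi] at hg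
        exact absurd (Subgroup.inv_mem _ (hEmem i)) hg
    · intro x
      by_cases hx : x ∈ Subgroup.zpowers a
      · obtain ⟨i, hi⟩ := hEsurj x hx
        exact ⟨.a i, hi⟩
      · obtain ⟨i, hi⟩ := hEsurj _ (htop x hx)
        refine ⟨xa i, ?_⟩
        change g * E i = x
        rw [hi, mul_inv_cancel_left]
  exact ⟨(MulEquiv.ofBijective ψ hψ).symm⟩

/-- A finite `2`-group with at most one involution is cyclic or generalized quaternion. -/
theorem isCyclic_or_isGeneralizedQuaternion [Finite G] (hG : IsPGroup 2 G)
    (hU : ∀ x y : G, x ^ 2 = 1 → x ≠ 1 → y ^ 2 = 1 → y ≠ 1 → x = y) :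
    IsCyclic G ∨ IsGeneralizedQuaternion G := by
  let S : Set (Subgroup G) := {A | A.Normal ∧ ∀ x ∈ A, ∀ y ∈ A, x * y = y * x}
  have hne : S.Nonempty := ⟨⊥, inferInstance, by simp⟩
  obtain ⟨A, ⟨hAn, hA⟩, hmax⟩ := (Set.toFinite S).exists_maximal hne
  have hC := centralizer_le_of_maximal hG hA fun B hB hBc => hmax ⟨hB, hBc⟩
  obtain ⟨a, rfl⟩ := exists_zpowers_eq_of_commutative hG hU A hA
  by_cases htop : ∀ g, g ∈ Subgroup.zpowers a
  · exact Or.inl ⟨a, htop⟩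
  right
  push Not at htop
  obtain ⟨g, hg⟩ := htop
  have hinv : ∀ x ∉ Subgroup.zpowers a, x * a * x⁻¹ = a⁻¹ := fun x hx =>
    conj_eq_inv_of_sq_mem hG hU hC hx (sq_mem_of_notMem hG hU hC hx)
  have hcent : ∀ x, x * a = a * x → x ∈ Subgroup.zpowers a := fun x hx => hC fun y hy => by
    obtain ⟨i, rfl⟩ := hy
    exact (show Commute a x from hx.symm).zpow_left i
  -- Two elements that both invert `a` differ by one centralizing it, so the cyclic subgroup has
  -- index two.
  have hcover : ∀ x ∉ Subgroup.zpowers a, g⁻¹ * x ∈ Subgroup.zpowers a := fun x hx => by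
    refine hcent _ ?_
    have h1 := hinv x hx
    have h2 := hinv g hg
    have h3 : g⁻¹ * a⁻¹ * g = a := by rw [← h2]; group
    calc g⁻¹ * x * a = g⁻¹ * (x * a * x⁻¹) * x := by group
      _ = g⁻¹ * a⁻¹ * g * (g⁻¹ * x) := by rw [h1]; group
      _ = a * (g⁻¹ * x) := by rw [h3]
  have ha2 : a ^ 2 ≠ 1 := fun h => by
    have ha : a⁻¹ = a := inv_eq_of_mul_eq_one_left (by rw [← sq, h])
    have h1 := hinv g hg
    rw [ha, mul_inv_eq_iff_eq_mul] at h1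
    exact hg (hcent g h1)
  obtain ⟨s, hs⟩ := (IsPGroup.iff_orderOf.1 hG) a
  have hs2 : 2 ≤ s := by
    by_contra! h
    refine ha2 (orderOf_dvd_iff_pow_eq_one.1 ?_)
    rw [hs]
    exact pow_dvd_pow 2 (by lia : s ≤ 1)
  obtain ⟨m, rfl⟩ : ∃ m, s = m + 1 := ⟨s - 1, by lia⟩
  rw [pow_succ'] at hs
  -- The relation `g ^ 2 = a ^ 2 ^ m` holds because both sides are involutions: `g` fixes and
  -- inverts `g ^ 2`, so `g ^ 4 = 1`.
  refine ⟨m, by lia, exists_mulEquiv_quaternionGroup hs (hinv g hg) (hU _ _ ?_ ?_ ?_ ?_) hg hcover⟩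
  · obtain ⟨i, hi⟩ := sq_mem_of_notMem hG hU hC hg
    change a ^ i = g ^ 2 at hi
    have h1 : g * (g ^ 2) * g⁻¹ = (g ^ 2)⁻¹ := by
      rw [← hi, ← conj_zpow, hinv g hg, inv_zpow]
    have h2 : g * g ^ 2 * g⁻¹ = g ^ 2 := by group
    rw [h2] at h1
    nth_rw 1 [sq (g ^ 2), h1]
    exact inv_mul_cancel _
  · intro h
    refine hg (mem_of_sq_eq_one hG hU ?_ h)
    rw [Ne, Subgroup.zpowers_eq_bot]
    rintro rfl
    simp at ha2
  · rw [← pow_mul, mul_comm, ← hs, pow_orderOf_eq_one]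
  · rw [Ne, ← orderOf_dvd_iff_pow_eq_one, hs]
    intro h
    have := Nat.le_of_dvd (by positivity) h
    have : 0 < 2 ^ m := by positivity
    lia

lemma exists_addEquiv_galoisField_two {p : ℕ} [Fact p.Prime] {V : Type*} [AddCommGroup V]
    [Module (ZMod p) V] (hcard : Nat.card V = p ^ 2) : Nonempty (GaloisField p 2 ≃+ V) := by
  have : Finite V := Nat.finite_of_card_ne_zero
    (hcard ▸ pow_ne_zero 2 (Fact.out : p.Prime).ne_zero)
  have : Module.Finite (ZMod p) V := Module.Finite.of_finite
  have hfin : Module.finrank (ZMod p) V = 2 := by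
    have h := Module.natCard_eq_pow_finrank (K := ZMod p) (V := V)
    rw [Nat.card_zmod] at h
    exact Nat.pow_right_injective (Fact.out : p.Prime).two_le (h.symm.trans hcard)
  exact ⟨(LinearEquiv.ofFinrankEq (R := ZMod p) (GaloisField p 2) V
    ((GaloisField.finrank p two_ne_zero).trans hfin.symm)).toAddEquiv⟩

lemma exists_mulEquiv_galoisField_two {p : ℕ} [Fact p.Prime] {H : Type*} [Group H]
    (hcomm : ∀ x y : H, x * y = y * x) (hpow : ∀ x : H, x ^ p = 1) (hcard : Nat.card H = p ^ 2) :
    Nonempty (Multiplicative (GaloisField p 2) ≃* H) :=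
  let _ : CommGroup H := { ‹Group H› with mul_comm := hcomm }
  let _ : Module (ZMod p) (Additive H) := AddCommGroup.zmodModule fun x =>
    congr_arg Additive.ofMul (hpow x.toMul)
  (exists_addEquiv_galoisField_two (V := Additive H) hcard).map AddEquiv.toMultiplicativeLeft

/-- A second involution would generate with a central one a copy of (ℤ/2)², which is obstructed. -/
lemma HasPropertyL.eq_of_sq_eq_one [Finite G] (hG : IsPGroup 2 G) (hL : HasPropertyL 2 G)
    (x y : G) (hx : x ^ 2 = 1) (hx1 : x ≠ 1) (hy : y ^ 2 = 1) (hy1 : y ≠ 1) : x = y := by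
  have : Nontrivial G := ⟨x, 1, hx1⟩
  obtain ⟨z, hz, hz2, hz1⟩ := exists_sq_eq_one_of_ne_bot hG hG.bot_lt_center.ne'
  have key : ∀ w : G, w ^ 2 = 1 → w ≠ 1 → w = z := fun w hw hw1 => by
    by_contra hwz
    have hzw : ∀ g : G, Commute g z := fun g => Subgroup.mem_center_iff.1 hz g
    let φ := ((Subgroup.zpowers w).subtype.noncommCoprod (Subgroup.zpowers z).subtype
      (by
        rintro ⟨_, i, rfl⟩ ⟨_, j, rfl⟩
        exact (hzw w).zpow_zpow i j))
    have hcard : ∀ v : G, v ^ 2 = 1 → v ≠ 1 → Nat.card (Subgroup.zpowers v) = 2 :=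
      fun v hv hv1 => by rw [Nat.card_zpowers]; exact orderOf_eq_prime hv hv1
    have hmem : ∀ v : G, v ^ 2 = 1 → ∀ u ∈ Subgroup.zpowers v, u = 1 ∨ u = v := by
      rintro v hv _ ⟨i, rfl⟩
      rcases Int.even_or_odd' i with ⟨l, rfl | rfl⟩
      · left
        change v ^ (2 * l) = 1
        rw [zpow_mul]
        exact_mod_cast (by rw [hv, one_zpow] : (v ^ 2) ^ l = 1)
      · right
        change v ^ (2 * l + 1) = v
        rw [zpow_add_one, zpow_mul]
        have : (v ^ 2) ^ l = 1 := by rw [hv, one_zpow]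
        have h2 : v ^ (2 : ℤ) = v ^ 2 := by norm_cast
        rw [h2, this, one_mul]
    have hφ : Function.Injective φ := by
      rw [MonoidHom.noncommCoprod_injective]
      refine ⟨Subtype.val_injective, Subtype.val_injective, ?_⟩
      rw [Subgroup.range_subtype, Subgroup.range_subtype, Subgroup.disjoint_def]
      intro u hu hu'
      rcases hmem w hw u hu with h | h
      · exact h
      · rcases hmem z hz2 u hu' with h' | h'
        · exact h'
        · exact absurd (h.symm.trans h') hwz
    have hsq : ∀ v : G, v ^ 2 = 1 → ∀ u : Subgroup.zpowers v, u ^ 2 = 1 := fun v hv u => by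
      rcases hmem v hv u u.2 with h | h
      · exact Subtype.ext (by simp [h])
      · exact Subtype.ext (by simp [h, hv])
    obtain ⟨e⟩ := exists_mulEquiv_galoisField_two (p := 2)
      (H := Subgroup.zpowers w × Subgroup.zpowers z)
      (fun u v => Prod.ext (IsMulCommutative.is_comm.comm u.1 v.1)
        (IsMulCommutative.is_comm.comm u.2 v.2))
      (fun u => Prod.ext (hsq w hw u.1) (hsq z hz2 u.2))
      (by rw [Nat.card_prod, hcard w hw hw1, hcard z hz2 hz1, sq])
    exact not_hasPropertyL_galoisField_two
      (hL.of_injective (φ.comp e.toMonoidHom) (hφ.comp e.injective))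
  rw [key x hx hx1, key y hy hy1]

lemma subsingleton_of_hasPropertyL {p : ℕ} [Fact p.Prime] (hp : 3 < p) [Finite G]
    (hG : IsPGroup p G) (hL : HasPropertyL p G) : Subsingleton G := by
  rcases hG.card_eq_or_dvd with h | h
  · exact (Nat.card_eq_one_iff_unique.1 h).1
  · obtain ⟨K, hK⟩ := Sylow.exists_subgroup_card_pow_prime p (n := 1) (by rwa [pow_one])
    rw [pow_one] at hK
    let e : K ≃* Multiplicative (ZMod p) := mulEquivOfPrimeCardEq (p := p) hK (by simp)
    exact absurd ((hL.subgroup K).of_mulEquiv e) (not_hasPropertyL_multiplicative_zmod hp)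

lemma hasPropertyL_of_subsingleton {p : ℕ} [Fact p.Prime] [Subsingleton G] :
    HasPropertyL p G := fun k _ _ _ n _ f => ⟨1, by
  ext x : 1
  rw [Subsingleton.elim x 1, map_one, map_one]⟩

lemma not_hasPropertyL_of_card_eq_nine [Finite G] (hcard : Nat.card G = 3 ^ 2) :
    ¬ HasPropertyL 3 G := by
  intro hL
  by_cases hcyc : IsCyclic G
  · exact not_hasPropertyL_multiplicative_zmod_nine
      (hL.of_mulEquiv (mulEquivOfCyclicCardEq (by simp [hcard])))
  · obtain ⟨e⟩ := exists_mulEquiv_galoisField_two (p := 3)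
      (IsPGroup.isMulCommutative_of_card_eq_prime_sq hcard).is_comm.comm (fun x => by
        obtain ⟨m, hm, hx⟩ := (Nat.dvd_prime_pow Nat.prime_three).1 (hcard ▸ orderOf_dvd_natCard x)
        rw [← orderOf_dvd_iff_pow_eq_one, hx]
        have hm2 : m ≠ 2 := by
          rintro rfl
          exact hcyc (isCyclic_of_orderOf_eq_card x (hx.trans hcard.symm))
        exact pow_dvd_pow 3 (by lia : m ≤ 1)) hcard
    exact not_hasPropertyL_galoisField_three (hL.of_mulEquiv e.symm)

lemma hasPropertyL_three_iff [Finite G] (hG : IsPGroup 3 G) :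
    HasPropertyL 3 G ↔ Subsingleton G ∨ Nonempty (G ≃* Multiplicative (ZMod 3)) := by
  constructor
  · intro hL
    obtain ⟨n, hn⟩ := IsPGroup.iff_card.1 hG
    match n, hn with
    | 0, hn => exact Or.inl (Nat.card_eq_one_iff_unique.1 hn).1
    | 1, hn => exact Or.inr ⟨mulEquivOfPrimeCardEq (p := 3) hn (by simp)⟩
    | n + 2, hn =>
      obtain ⟨K, hK⟩ := Sylow.exists_subgroup_card_pow_prime (G := G) 3 (n := 2)
        (hn ▸ pow_dvd_pow 3 (by lia))
      exact absurd (hL.subgroup K) (not_hasPropertyL_of_card_eq_nine hK)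
  · rintro (h | ⟨⟨e⟩⟩)
    · exact hasPropertyL_of_subsingleton
    · exact hasPropertyL_three_multiplicative_zmod.of_mulEquiv ‹G ≃* _›.symm

end Classification

end LiftableGroups

theorem mainTheorem5 :
    (∀ (p : ℕ) [Fact p.Prime], 3 < p →
      ∀ (G : Type u) [Group G] [Finite G], IsPGroup p G →
        (LiftableGroups.HasPropertyL p G ↔ Subsingleton G)) ∧
    (∀ (G : Type u) [Group G] [Finite G], IsPGroup 3 G →
      (LiftableGroups.HasPropertyL 3 G ↔
        Subsingleton G ∨ Nonempty (G ≃* Multiplicative (ZMod 3)))) ∧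
    (∀ n : ℕ, LiftableGroups.HasPropertyL 2 (Multiplicative (ZMod (2 ^ n)))) ∧
    (∀ (G : Type u) [Group G] [Finite G], IsPGroup 2 G → LiftableGroups.HasPropertyL 2 G →
      IsCyclic G ∨ LiftableGroups.IsGeneralizedQuaternion G) :=
  ⟨fun _ _ hp _ _ _ hG => ⟨LiftableGroups.subsingleton_of_hasPropertyL hp hG,
      fun _ => LiftableGroups.hasPropertyL_of_subsingleton⟩,
    fun _ _ _ hG => LiftableGroups.hasPropertyL_three_iff hG,
    LiftableGroups.hasPropertyL_two_multiplicative_zmod,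
    fun _ _ _ hG hL => LiftableGroups.isCyclic_or_isGeneralizedQuaternion hG
      (LiftableGroups.HasPropertyL.eq_of_sq_eq_one hG hL)⟩
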